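/- Let $d\ge 0$ and let $X$ be a random point uniformly distributed in the cube $[0,1]^d$. For a set $C\subset\mathbb R^d$ write $X_C=\#\big((C+X)\cap\mathbb Z^d\big)$ for the number of integer points in the translate of $C$ by $X$. A zonotope is a Minkowski sum of finitely many line segments in $\mathbb R^d$; it is an integer zonotope if all of its vertices (extreme points) lie in $\mathbb Z^d$. (In particular, every Minkowski sum of finitely many segments with endpoints in $\mathbb Z^d$ is an integer zonotope.) If $P\subset\mathbb R^d$ is an integer zonotope, then $X_P$ is almost surely constant: there is an integer $c\ge 0$ such that $X_P=c$ with probability $1$. -/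

import Mathlib

open scoped Pointwise

/-- The integer points `ℤ^d` of `ℝ^d`. -/
def integerPoints (d : ℕ) : Set (Fin d → ℝ) :=
  {x | ∀ i, ∃ m : ℤ, x i = (m : ℝ)}

/-- A zonotope in `ℝ^d`: a (pointwise) Minkowski sum of finitely many line segments. -/
def IsZonotope {d : ℕ} (P : Set (Fin d → ℝ)) : Prop :=
  ∃ (n : ℕ) (a b : Fin n → Fin d → ℝ), P = ∑ k, segment ℝ (a k) (b k)

/-- All vertices (extreme points) of `P` are integer points. -/
def HasIntegerVertices {d : ℕ} (P : Set (Fin d → ℝ)) : Prop :=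
  Set.extremePoints ℝ P ⊆ integerPoints d

/-- An integer zonotope: a zonotope all of whose vertices are integer points. -/
def IsIntegerZonotope {d : ℕ} (P : Set (Fin d → ℝ)) : Prop :=
  IsZonotope P ∧ HasIntegerVertices P

/-- The number of integer points in the translate `P + x`, as an extended natural number
(so that no junk value is used for an infinite set). -/
noncomputable def latticeCount {d : ℕ} (P : Set (Fin d → ℝ)) (x : Fin d → ℝ) : ℕ∞ :=
  ((P + {x}) ∩ integerPoints d).encard

/-! ### Counting the points gained by adding a segment. -/

section Counting

/-! Add the generators one at a time. Passing from `K` to `K + [0, v]` with `v ∈ L` adds, on each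
line parallel to `v` meeting both `K` and `L`, a half-open translate of `[0, v]`, and all of these
contain equally many points of `L` (`encard_add_segment_inter`). The number of such lines is the
same kind of count for the projection of `K` along `v`, so induction on the number of generators
makes both terms constant off countably many proper affine subspaces
(`exists_encard_zonotope_add_inter_eq`), a null set. The given segments need not be integral. Once
parallel ones are merged, each generator is an edge, hence a difference of two integer vertices
(`IsReducedGenerators.mem_addSubgroup`). -/

/-- Reduction modulo 1 is the bijection; it stays in `H` because `H` contains `ℤ`. -/
theorem nonempty_equiv_Ioc_add_one_inter_addSubgroup (H : AddSubgroup ℝ) (h1 : (1 : ℝ) ∈ H)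
    (a b : ℝ) :
    Nonempty ((Set.Ioc a (a + 1) ∩ H : Set ℝ) ≃ (Set.Ioc b (b + 1) ∩ H : Set ℝ)) := by
  have hp : (0 : ℝ) < 1 := one_pos
  have key (a t : ℝ) (ht : t ∈ H) : toIocMod hp a t ∈ Set.Ioc a (a + 1) ∩ H := by
    refine ⟨toIocMod_mem_Ioc hp a t, ?_⟩
    rw [← self_sub_toIocDiv_zsmul]
    exact H.sub_mem ht (H.zsmul_mem h1 _)
  refine ⟨⟨fun t => ⟨toIocMod hp b t, key b t t.2.2⟩,
    fun t => ⟨toIocMod hp a t, key a t t.2.2⟩, ?_, ?_⟩⟩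
  · rintro ⟨t, ht, -⟩
    simpa [toIocMod_toIocMod, Subtype.ext_iff] using (toIocMod_eq_self hp).2 ht
  · rintro ⟨t, ht, -⟩
    simpa [toIocMod_toIocMod, Subtype.ext_iff] using (toIocMod_eq_self hp).2 ht

theorem encard_eq_mul_of_equiv_fiber {α β γ : Type*} (f : α → β) {A : Set α} {B : Set β}
    (hf : Set.MapsTo f A B) {G : Set γ}
    (hG : ∀ y ∈ B, Nonempty ((A ∩ f ⁻¹' {y} : Set α) ≃ G)) :
    A.encard = B.encard * G.encard := by
  rw [← Set.encard_prod]
  have e' (y : B) : {x : A // hf.restrict f A B x = y} ≃ G :=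
    (Equiv.mk (fun x => ⟨x.1.1, x.1.2, congrArg Subtype.val x.2⟩)
      (fun x => ⟨⟨x.1, x.2.1⟩, Subtype.ext x.2.2⟩) (fun _ => rfl) (fun _ => rfl)).trans
      (hG y y.2).some
  exact Set.encard_congr ((Equiv.sigmaFiberEquiv (hf.restrict f A B)).symm.trans
    ((Equiv.sigmaCongrRight e').trans ((Equiv.sigmaEquivProd B G).trans (Equiv.Set.prod B G).symm)))

/-- The real numbers `s` with `s • v ∈ L`. -/
def smulAddSubgroup {V : Type*} [AddCommGroup V] [Module ℝ V] (L : AddSubgroup V) (v : V) :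
    AddSubgroup ℝ :=
  L.comap (LinearMap.toSpanSingleton ℝ V v).toAddMonoidHom

variable {V : Type*} [NormedAddCommGroup V] [NormedSpace ℝ V]

theorem mem_smulAddSubgroup {L : AddSubgroup V} {v : V} {s : ℝ} :
    s ∈ smulAddSubgroup L v ↔ s • v ∈ L := Iff.rfl

/-- On each line in direction `v` that meets a compact convex set `K`, the set
`(K + [0, v]) \ K` is a half-open translate of `[0, v]`. -/
theorem exists_mem_add_segment_diff_iff {K : Set V} (hK : IsCompact K) (hc : Convex ℝ K) {v : V}
    (hv : v ≠ 0) {r : V} (hr : ∃ t : ℝ, r + t • v ∈ K) :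
    ∃ a : ℝ, ∀ t : ℝ, r + t • v ∈ (K + segment ℝ 0 v) \ K ↔ t ∈ Set.Ioc a (a + 1) := by
  have hT : IsCompact ((fun t : ℝ => r + t • v) ⁻¹' K) :=
    ((Homeomorph.addLeft r).isClosedEmbedding.comp
      (isClosedEmbedding_smul_left hv)).isCompact_preimage hK
  -- The line meets `K` in an interval with last parameter `a`; adding `[0, v]` prolongs it to `a +
  -- 1`.
  obtain ⟨a, haK, ha⟩ := hT.exists_isGreatest hr
  refine ⟨a, fun t => ⟨?_, ?_⟩⟩
  · rintro ⟨⟨k, hk, w, hw, hkw⟩, hn⟩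
    rw [segment_eq_image'] at hw
    obtain ⟨s, ⟨hs0, hs1⟩, rfl⟩ := hw
    have hts : r + (t - s) • v ∈ K := by
      convert hk using 1
      simp only [sub_zero, zero_add] at hkw
      rw [sub_smul, ← add_sub_assoc, ← hkw, add_sub_cancel_right]
    have h1 : t - s ≤ a := ha hts
    refine ⟨?_, by linarith⟩
    by_contra! hta
    refine hn ?_
    have hc' : Convex ℝ ((fun t : ℝ => r + t • v) ⁻¹' K) :=
      (hc.translate_preimage_right r).linear_preimage (LinearMap.toSpanSingleton ℝ V v)
    exact hc'.ordConnected.out hts haK ⟨by linarith, hta⟩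
  · rintro ⟨h1, h2⟩
    refine ⟨⟨r + a • v, haK, (t - a) • v, ?_, ?_⟩, fun h => ?_⟩
    · rw [segment_eq_image']
      exact ⟨t - a, ⟨by linarith, by linarith⟩, by simp⟩
    · simp only [sub_smul]; abel
    · exact absurd (ha h) (by linarith)

/-- Adding `[0, v]` to a compact convex `K` adds, on each line in direction `v` that meets both
`K` and `L`, as many points of `L` as a half-open translate of `[0, v]` contains. -/
theorem encard_add_segment_inter {K : Set V} (hK : IsCompact K) (hc : Convex ℝ K) {v : V}
    (hv : v ≠ 0) {L : AddSubgroup V} (hvL : v ∈ L) :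
    ((K + segment ℝ 0 v) ∩ L).encard = (K ∩ L).encard +
      ((Submodule.span ℝ {v}).mkQ '' K ∩
        L.map (Submodule.span ℝ {v}).mkQ.toAddMonoidHom).encard *
      (Set.Ioc (0 : ℝ) (0 + 1) ∩ smulAddSubgroup L v).encard := by
  set π := (Submodule.span ℝ {v}).mkQ with hπ
  have hsub : K ⊆ K + segment ℝ 0 v := fun k hk =>
    ⟨k, hk, 0, left_mem_segment ℝ _ _, add_zero k⟩
  have hπv (t : ℝ) : π (t • v) = 0 := by
    simp [hπ]
  have hsplit : (K + segment ℝ 0 v) ∩ L = K ∩ L ∪ ((K + segment ℝ 0 v) \ K) ∩ L := by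
    rw [← Set.union_inter_distrib_right, Set.union_sdiff_cancel hsub]
  rw [hsplit, Set.encard_union_eq
    ((Set.disjoint_sdiff_right).mono Set.inter_subset_left Set.inter_subset_left)]
  congr 1
  refine encard_eq_mul_of_equiv_fiber π ?_ ?_
  · rintro _ ⟨⟨⟨k, hk, w, hw, rfl⟩, -⟩, hL⟩
    refine ⟨⟨k, hk, ?_⟩, ⟨_, hL, rfl⟩⟩
    rw [segment_eq_image'] at hw
    obtain ⟨s, -, rfl⟩ := hw
    simp only [sub_zero, zero_add, map_add, hπv, add_zero]
  · rintro _ ⟨⟨k, hk, hkr⟩, ⟨r, hrL, rfl⟩⟩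
    have hline {x : V} (hx : π x = π r) : ∃ t : ℝ, r + t • v = x := by
      rw [← sub_eq_zero, ← map_sub, hπ, Submodule.mkQ_apply, Submodule.Quotient.mk_eq_zero,
        Submodule.mem_span_singleton] at hx
      obtain ⟨t, ht⟩ := hx
      exact ⟨t, by rw [ht]; abel⟩
    obtain ⟨t₀, ht₀⟩ := hline hkr
    obtain ⟨a, ha⟩ := exists_mem_add_segment_diff_iff hK hc hv (r := r) ⟨t₀, ht₀ ▸ hk⟩
    have h1 : (1 : ℝ) ∈ smulAddSubgroup L v := by simpa [mem_smulAddSubgroup] using hvL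
    obtain ⟨e⟩ := nonempty_equiv_Ioc_add_one_inter_addSubgroup _ h1 a 0
    have hinj : Function.Injective (fun t : ℝ => r + t • v) :=
      (add_right_injective r).comp (smul_left_injective ℝ hv)
    refine ⟨(Equiv.setCongr ?_).trans ((Equiv.Set.image _ _ hinj).symm.trans e)⟩
    ext x
    constructor
    · rintro ⟨⟨hx, hxL⟩, hxr⟩
      obtain ⟨t, rfl⟩ := hline hxr
      refine ⟨t, ⟨(ha t).1 hx, ?_⟩, rfl⟩
      exact (L.add_mem_cancel_left hrL).1 hxL
    · rintro ⟨t, ⟨ht, htL⟩, rfl⟩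
      refine ⟨⟨(ha t).2 ht, L.add_mem hrL htL⟩, ?_⟩
      simp only [Set.mem_preimage, map_add, hπv, add_zero]
      rfl

end Counting

/-! ### Generic translates of zonotopes. -/

section Zonotope

/-- The Minkowski sum of the segments `[0, v]`, `v` in the list `l`. -/
def zonotope {V : Type*} [AddCommGroup V] [Module ℝ V] (l : List V) : Set V :=
  (l.map (segment ℝ 0)).sum

section Algebra

variable {V : Type*} [AddCommGroup V] [Module ℝ V]

@[simp] theorem zonotope_nil : zonotope ([] : List V) = {0} := rfl

@[simp] theorem zonotope_cons (v : V) (l : List V) :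
    zonotope (v :: l) = segment ℝ 0 v + zonotope l := by simp [zonotope]

theorem zonotope_perm {l l' : List V} (h : l.Perm l') : zonotope l = zonotope l' :=
  (h.map _).sum_eq

theorem zonotope_map {W : Type*} [AddCommGroup W] [Module ℝ W] (f : V →ₗ[ℝ] W) (l : List V) :
    zonotope (l.map f) = f '' zonotope l := by
  induction l with
  | nil => simp
  | cons v l ih =>
    have h := image_segment ℝ f.toAffineMap 0 v
    simp only [LinearMap.coe_toAffineMap, map_zero] at h
    rw [List.map_cons, zonotope_cons, zonotope_cons, ih, Set.image_add, h]

theorem convex_zonotope (l : List V) : Convex ℝ (zonotope l) := by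
  induction l with
  | nil => simp
  | cons v l ih => exact zonotope_cons v l ▸ (convex_segment 0 v).add ih

end Algebra

theorem isCompact_segment_zero {V : Type*} [NormedAddCommGroup V] [NormedSpace ℝ V] (v : V) :
    IsCompact (segment ℝ 0 v) := by
  rw [segment_eq_image']
  exact isCompact_Icc.image (by fun_prop)

theorem isCompact_zonotope {V : Type*} [NormedAddCommGroup V] [NormedSpace ℝ V] (l : List V) :
    IsCompact (zonotope l) := by
  induction l with
  | nil => simp
  | cons v l ih => exact zonotope_cons v l ▸ (isCompact_segment_zero v).add ih

/-- If the generators of a zonotope lie in a countable subgroup `L`, its translates by vectors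
outside countably many proper affine subspaces contain equally many points of `L`. -/
theorem exists_encard_zonotope_add_inter_eq (n : ℕ) :
    ∀ (V : Type*) [NormedAddCommGroup V] [NormedSpace ℝ V] (L : AddSubgroup V)
      (_ : (L : Set V).Countable) (l : List V) (_ : l.length = n) (_ : ∀ v ∈ l, v ∈ L),
      ∃ c : ℕ∞, ∃ S : Set (AffineSubspace ℝ V), S.Countable ∧ (∀ E ∈ S, E ≠ ⊤) ∧
        ∀ x, (∀ E ∈ S, x ∉ E) → ((zonotope l + {x}) ∩ L).encard = c := by
  induction n with
  | zero =>
    intro V _ _ L hL l hl _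
    obtain rfl := List.length_eq_zero_iff.1 hl
    -- In the zero space a point is not a proper subspace, so the count is 1; otherwise the points
    -- of `L` are the exceptions.
    rcases subsingleton_or_nontrivial V with hV | hV
    · refine ⟨1, ∅, Set.countable_empty, by simp, fun x _ => ?_⟩
      rw [Set.encard_eq_one]
      refine ⟨0, Set.ext fun y => ?_⟩
      simp [Subsingleton.elim y 0, Subsingleton.elim x 0, L.zero_mem]
    · refine ⟨0, (fun p => affineSpan ℝ {p}) '' L, hL.image _, ?_, fun x hx => ?_⟩
      · rintro _ ⟨p, -, rfl⟩ h
        obtain ⟨q, hq⟩ := exists_ne p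
        have h' : affineSpan ℝ {p} = ⊤ := h
        have : q ∈ affineSpan ℝ {p} := h' ▸ AffineSubspace.mem_top ℝ V q
        exact hq (by simpa using this)
      · rw [Set.encard_eq_zero, Set.eq_empty_iff_forall_notMem]
        rintro y ⟨hy, hyL⟩
        obtain rfl : y = x := by simpa using hy
        exact hx _ ⟨y, hyL, rfl⟩ (by simp)
  | succ n ih =>
    intro V _ _ L hL l hl hlL
    obtain ⟨v, l, rfl⟩ := List.exists_cons_of_length_eq_add_one hl
    simp only [List.length_cons, Nat.add_right_cancel_iff] at hl
    simp only [List.mem_cons, forall_eq_or_imp] at hlL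
    obtain ⟨c, S, hS, hS', hc⟩ := ih V L hL l hl hlL.2
    rcases eq_or_ne v 0 with rfl | hv
    · refine ⟨c, S, hS, hS', fun x hx => ?_⟩
      simpa using hc x hx
    set π := (Submodule.span ℝ {v}).mkQ with hπ
    -- Closedness makes the quotient a normed space, as the induction hypothesis requires.
    have : IsClosed ((Submodule.span ℝ {v} : Submodule ℝ V) : Set V) :=
      Submodule.closed_of_finiteDimensional _
    obtain ⟨c', S', hS₁, hS₂, hc'⟩ := ih (V ⧸ Submodule.span ℝ {v}) (L.map π.toAddMonoidHom)
      (by simpa using hL.image π) (l.map π) (by simpa using hl)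
      (by
        intro w hw
        obtain ⟨u, hu, rfl⟩ := List.mem_map.1 hw
        exact ⟨u, hlL.2 u hu, rfl⟩)
    refine ⟨c + c' * (Set.Ioc (0 : ℝ) (0 + 1) ∩ smulAddSubgroup L v).encard,
      S ∪ (fun E => E.comap π.toAffineMap) '' S', hS.union (hS₁.image _), ?_, fun x hx => ?_⟩
    · rintro E (hE | ⟨E, hE, rfl⟩)
      · exact hS' E hE
      · intro h
        refine hS₂ E hE (eq_top_iff.2 fun y _ => ?_)
        obtain ⟨z, rfl⟩ := (Submodule.span ℝ {v}).mkQ_surjective y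
        have h' : E.comap π.toAffineMap = ⊤ := h
        have : z ∈ E.comap π.toAffineMap := h' ▸ AffineSubspace.mem_top ℝ V z
        exact this
    · have hx₁ := hc x fun E hE => hx E (Or.inl hE)
      have hx₂ := hc' (π x) fun E hE hxE => hx _ (Or.inr ⟨E, hE, rfl⟩) hxE
      rw [zonotope_map] at hx₂
      rw [zonotope_cons, add_assoc, add_comm, encard_add_segment_inter
        ((isCompact_zonotope l).add isCompact_singleton)
        ((convex_zonotope l).add (convex_singleton x)) hv hlL.1, hx₁, ← hx₂, Set.image_add,
        Set.image_singleton]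

end Zonotope

/-! ### Merging parallel generators and finding edges. -/

section Reduction

variable {V : Type*} [AddCommGroup V] [Module ℝ V]

/-- A list of nonzero, pairwise non-parallel vectors. -/
structure IsReducedGenerators (l : List V) : Prop where
  ne_zero : ∀ v ∈ l, v ≠ 0
  pairwise : l.Pairwise fun v w => Submodule.span ℝ {v} ≠ Submodule.span ℝ {w}

theorem IsReducedGenerators.perm {l l' : List V} (h : IsReducedGenerators l) (hl : l.Perm l') :
    IsReducedGenerators l' :=
  ⟨fun v hv => h.ne_zero v (hl.mem_iff.2 hv), hl.pairwise h.pairwise fun h => h.symm⟩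

theorem isReducedGenerators_cons {v : V} {l : List V} : IsReducedGenerators (v :: l) ↔
    v ≠ 0 ∧ (∀ w ∈ l, Submodule.span ℝ {v} ≠ Submodule.span ℝ {w}) ∧ IsReducedGenerators l := by
  constructor
  · rintro ⟨h₁, h₂⟩
    rw [List.pairwise_cons] at h₂
    exact ⟨h₁ v (by simp), h₂.1, fun w hw => h₁ w (by simp [hw]), h₂.2⟩
  · rintro ⟨h₁, h₂, h₃⟩
    refine ⟨fun w hw => ?_, List.pairwise_cons.2 ⟨h₂, h₃.pairwise⟩⟩
    rcases List.mem_cons.1 hw with rfl | hw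
    exacts [h₁, h₃.ne_zero w hw]

theorem segment_smul_add_segment (c : ℝ) (w : V) :
    segment ℝ 0 (c • w) + segment ℝ 0 w = {min 0 c • w} + segment ℝ 0 ((1 + |c|) • w) := by
  have key (a : ℝ) : segment ℝ 0 (a • w) = LinearMap.toSpanSingleton ℝ V w '' segment ℝ 0 a := by
    simpa using (image_segment ℝ (LinearMap.toSpanSingleton ℝ V w).toAffineMap 0 a).symm
  have hR : segment ℝ 0 c + segment ℝ 0 1 = {min 0 c} + segment ℝ 0 (1 + |c|) := by
    rw [segment_eq_uIcc, segment_eq_Icc zero_le_one, segment_eq_Icc (by positivity), Set.uIcc,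
      Set.Icc_add_Icc inf_le_sup zero_le_one, Set.singleton_add, Set.image_const_add_Icc]
    congr 1
    rcases le_total 0 c with h | h
    · simp [h, abs_of_nonneg, add_comm]
    · simp [h, abs_of_nonpos]
  have h1 := key 1
  rw [one_smul] at h1
  rw [key, h1, key, ← Set.image_add, hR, Set.image_add, Set.image_singleton]
  simp

theorem segment_eq_singleton_add (a b : V) : segment ℝ a b = {a} + segment ℝ 0 (b - a) := by
  rw [segment_eq_image', segment_eq_image', Set.singleton_add, Set.image_image]
  simp

/-- At most one generator is parallel to `v`; merging `v` into it keeps its span, so the list stays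
reduced. -/
theorem IsReducedGenerators.exists_segment_add {l : List V} (hl : IsReducedGenerators l) (v : V) :
    ∃ (p : V) (l' : List V), segment ℝ 0 v + zonotope l = {p} + zonotope l' ∧
      IsReducedGenerators l' := by
  classical
  rcases eq_or_ne v 0 with rfl | hv
  · exact ⟨0, l, by simp, hl⟩
  by_cases h : ∃ w ∈ l, Submodule.span ℝ {v} = Submodule.span ℝ {w}
  · obtain ⟨w, hw, hvw⟩ := h
    obtain ⟨c, rfl⟩ := Submodule.mem_span_singleton.1
      (hvw ▸ Submodule.mem_span_singleton_self v : v ∈ Submodule.span ℝ {w})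
    have hperm := List.perm_cons_erase hw
    obtain ⟨hw0, hpar, hred⟩ := isReducedGenerators_cons.1 (hl.perm hperm)
    have hc : (1 + |c|) ≠ 0 := by positivity
    refine ⟨min 0 c • w, ((1 + |c|) • w) :: l.erase w, ?_,
      isReducedGenerators_cons.2 ⟨?_, ?_, hred⟩⟩
    · rw [zonotope_perm hperm, zonotope_cons, zonotope_cons, ← add_assoc, ← add_assoc,
        segment_smul_add_segment]
    · exact smul_ne_zero hc hw0
    · rwa [Submodule.span_singleton_smul_eq (IsUnit.mk0 _ hc)]
  · push Not at h
    exact ⟨0, v :: l, by simp, isReducedGenerators_cons.2 ⟨hv, h, hl⟩⟩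

theorem exists_isReducedGenerators_sum_segment {ι : Type*} (s : Finset ι) (a b : ι → V) :
    ∃ (p : V) (l : List V),
      ∑ k ∈ s, segment ℝ (a k) (b k) = {p} + zonotope l ∧ IsReducedGenerators l := by
  classical
  induction s using Finset.induction_on with
  | empty => exact ⟨0, [], by simp [Set.singleton_zero], by simp, List.Pairwise.nil⟩
  | insert i s hi ih =>
    obtain ⟨p, l, h, hl⟩ := ih
    obtain ⟨p', l', h', hl'⟩ := hl.exists_segment_add (b i - a i)
    refine ⟨a i + p + p', l', ?_, hl'⟩
    rw [Finset.sum_insert hi, h, segment_eq_singleton_add, add_add_add_comm, h', ← add_assoc,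
      Set.singleton_add_singleton, Set.singleton_add_singleton]

/-- A linear form that vanishes on none of the generators has a unique maximizer. -/
theorem exists_unique_max_zonotope (φ : V →ₗ[ℝ] ℝ) {l : List V} (hl : ∀ w ∈ l, φ w ≠ 0) :
    ∃ q ∈ zonotope l, ∀ x ∈ zonotope l, φ x ≤ φ q ∧ (φ x = φ q → x = q) := by
  induction l with
  | nil => exact ⟨0, rfl, by simp⟩
  | cons v l ih =>
    simp only [List.mem_cons, forall_eq_or_imp] at hl
    obtain ⟨q, hq, hmax⟩ := ih hl.2
    have hseg : ∃ u ∈ segment ℝ 0 v, ∀ x ∈ segment ℝ 0 v, φ x ≤ φ u ∧ (φ x = φ u → x = u) := by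
      simp only [segment_eq_image', sub_zero, zero_add, Set.forall_mem_image, map_smul,
        smul_eq_mul]
      rcases hl.1.lt_or_gt with h | h
      · refine ⟨0, ⟨0, by simp⟩, fun t ht => ⟨?_, fun h' => ?_⟩⟩
        · simpa using mul_nonpos_of_nonneg_of_nonpos ht.1 h.le
        · have : t = 0 := by simpa [hl.1] using h'
          simp [this]
      · refine ⟨v, ⟨1, by simp⟩, fun t ht => ⟨?_, fun h' => ?_⟩⟩
        · exact mul_le_of_le_one_left h.le ht.2
        · have : t = 1 := by simpa [hl.1] using h'
          simp [this]
    obtain ⟨u, hu, humax⟩ := hseg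
    rw [zonotope_cons]
    refine ⟨u + q, Set.add_mem_add hu hq, ?_⟩
    rintro _ ⟨y, hy, x, hx, rfl⟩
    obtain ⟨h₁, h₂⟩ := hmax x hx
    obtain ⟨h₃, h₄⟩ := humax y hy
    simp only [map_add]
    refine ⟨add_le_add h₃ h₁, fun h => ?_⟩
    rw [h₂ (by linarith), h₄ (by linarith)]

/-- If `φ` attains its maximum over `B` only at `q` and vanishes on `A`, then the sums of `q` and
extreme points of `A` are extreme points of `A + B`. -/
theorem add_mem_extremePoints_add {A B : Set V} (φ : V →ₗ[ℝ] ℝ) (hA : ∀ x ∈ A, φ x = 0)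
    {q : V} (hq : q ∈ B) (hmax : ∀ x ∈ B, φ x ≤ φ q ∧ (φ x = φ q → x = q)) {u : V}
    (hu : u ∈ A.extremePoints ℝ) : u + q ∈ (A + B).extremePoints ℝ := by
  rw [mem_extremePoints_iff_left]
  refine ⟨Set.add_mem_add hu.1 hq, ?_⟩
  rintro _ ⟨y₁, hy₁, x₁, hx₁, rfl⟩ _ ⟨y₂, hy₂, x₂, hx₂, rfl⟩ ⟨α, β, hα, hβ, hαβ, h⟩
  have hφ := congrArg φ h
  simp only [map_add, map_smul, hA _ hy₁, hA _ hy₂, hA _ hu.1, smul_eq_mul, zero_add] at hφ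
  have hx₁' := hmax x₁ hx₁
  have hx₂' := hmax x₂ hx₂
  have e₁ : x₁ = q := hx₁'.2 (by
    refine le_antisymm hx₁'.1 ?_
    obtain rfl : β = 1 - α := by linarith
    by_contra! hlt
    nlinarith [mul_le_mul_of_nonneg_left hx₂'.1 hβ.le, mul_lt_mul_of_pos_left hlt hα])
  have e₂ : x₂ = q := hx₂'.2 (by
    refine le_antisymm hx₂'.1 ?_
    obtain rfl : α = 1 - β := by linarith
    by_contra! hlt
    nlinarith [mul_le_mul_of_nonneg_left hx₁'.1 hα.le, mul_lt_mul_of_pos_left hlt hβ])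
  subst e₁ e₂
  refine congrArg (· + _)
    ((mem_extremePoints_iff_left.1 hu).2 y₁ hy₁ y₂ hy₂ ⟨α, β, hα, hβ, hαβ, ?_⟩)
  have : α • (y₁ + x₂) + β • (y₂ + x₂) = α • y₁ + β • y₂ + x₂ := by
    rw [smul_add, smul_add, add_add_add_comm, ← add_smul, hαβ, one_smul]
  exact add_right_cancel (this.symm.trans h)

theorem mem_extremePoints_segment_zero (v : V) :
    0 ∈ (segment ℝ 0 v).extremePoints ℝ ∧ v ∈ (segment ℝ 0 v).extremePoints ℝ := by
  rcases eq_or_ne v 0 with rfl | hv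
  · simp
  constructor <;> rw [mem_extremePoints_iff_left] <;>
    refine ⟨by first | exact left_mem_segment ℝ _ _ | exact right_mem_segment ℝ _ _, ?_⟩ <;>
    simp only [segment_eq_image', sub_zero, zero_add, Set.forall_mem_image] <;>
    rintro s ⟨hs₀, hs₁⟩ t ⟨ht₀, ht₁⟩ ⟨α, β, hα, hβ, hαβ, h⟩ <;>
    rw [smul_smul, smul_smul, ← add_smul] at h
  · have h' : α * s + β * t = 0 := by simpa [hv] using h
    have : s = 0 := by
      by_contra hs
      have : 0 < s := lt_of_le_of_ne hs₀ (Ne.symm hs)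
      nlinarith [mul_pos hα this, mul_nonneg hβ.le ht₀]
    simp [this]
  · have h' : α * s + β * t = 1 := smul_left_injective ℝ hv (by simpa using h)
    have : s = 1 := by
      by_contra hs
      have : s < 1 := lt_of_le_of_ne hs₁ hs
      nlinarith [mul_pos hα (sub_pos.2 this), mul_nonneg hβ.le (sub_nonneg.2 ht₁)]
    simp [this]

theorem IsReducedGenerators.exists_linearMap {v : V} {l : List V}
    (h : IsReducedGenerators (v :: l)) :
    ∃ φ : V →ₗ[ℝ] ℝ, φ v = 0 ∧ ∀ w ∈ l, φ w ≠ 0 := by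
  obtain ⟨hv, hpar, hl⟩ := isReducedGenerators_cons.1 h
  -- Modulo `v` the other generators remain nonzero, so one linear form avoids all their kernels.
  obtain ⟨f, hf⟩ := Module.exists_dual_forall_apply_ne_zero (K := ℝ)
    (fun i : Fin l.length => (Submodule.span ℝ {v}).mkQ (l.get i)) (fun i hi => by
      rw [Submodule.mkQ_apply, Submodule.Quotient.mk_eq_zero, Submodule.mem_span_singleton] at hi
      obtain ⟨c, hc⟩ := hi
      have hc0 : c ≠ 0 := by
        rintro rfl
        exact hl.ne_zero _ (l.get_mem i) (by rw [← hc, zero_smul])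
      apply hpar _ (l.get_mem i)
      rw [← hc, Submodule.span_singleton_smul_eq (IsUnit.mk0 _ hc0)])
  refine ⟨f ∘ₗ (Submodule.span ℝ {v}).mkQ, ?_, fun w hw => ?_⟩
  · rw [LinearMap.comp_apply, Submodule.mkQ_apply, (Submodule.Quotient.mk_eq_zero _).2
      (Submodule.mem_span_singleton_self v), map_zero]
  obtain ⟨i, rfl⟩ := List.get_of_mem hw
  exact hf i

/-- The generators of a reduced representation of a zonotope are differences of vertices. -/
theorem IsReducedGenerators.mem_addSubgroup {l : List V} (hl : IsReducedGenerators l) {p : V}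
    {L : AddSubgroup V}
    (hL : ({p} + zonotope l).extremePoints ℝ ⊆ L) : ∀ v ∈ l, v ∈ L := by
  classical
  intro v hv
  have hperm := List.perm_cons_erase hv
  rw [zonotope_perm hperm, zonotope_cons] at hL
  -- The face where `φ` is maximal is the edge `p + q + [0, v]`.
  obtain ⟨φ, hφv, hφ⟩ := (hl.perm hperm).exists_linearMap
  obtain ⟨q, hq, hmax⟩ := exists_unique_max_zonotope φ hφ
  have hseg : ∀ x ∈ segment ℝ 0 v, φ x = 0 := by
    rw [segment_eq_image', Set.forall_mem_image]
    simp [hφv]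
  have key {u : V} (hu : u ∈ (segment ℝ 0 v).extremePoints ℝ) : u + (p + q) ∈ L := by
    apply hL
    rw [add_left_comm]
    refine add_mem_extremePoints_add φ hseg (Set.add_mem_add (Set.mem_singleton p) hq) ?_ hu
    rintro _ ⟨_, rfl, x, hx, rfl⟩
    simpa using hmax x hx
  obtain ⟨h₀, h₁⟩ := mem_extremePoints_segment_zero v
  simpa using L.sub_mem (key h₁) (key h₀)

end Reduction

/-! ### The integer lattice and null sets. -/

section Main

/-- The subgroup `ℤ^d` of `ℝ^d`. -/
def integerSubgroup (d : ℕ) : AddSubgroup (Fin d → ℝ) :=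
  AddSubgroup.pi Set.univ fun _ => (Int.castAddHom ℝ).range

theorem coe_integerSubgroup (d : ℕ) :
    (integerSubgroup d : Set (Fin d → ℝ)) = integerPoints d := by
  ext x
  simp [integerSubgroup, integerPoints, AddSubgroup.mem_pi,
    AddSubgroup.mem_zmultiples_iff, eq_comm]

theorem integerPoints_eq_range (d : ℕ) :
    integerPoints d = Set.range fun (m : Fin d → ℤ) i => (m i : ℝ) := by
  ext x
  simp only [integerPoints, Set.mem_ofPred_eq, Set.mem_range, funext_iff]
  exact ⟨fun h => ⟨fun i => (h i).choose, fun i => (h i).choose_spec.symm⟩,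
    fun ⟨m, hm⟩ i => ⟨m i, (hm i).symm⟩⟩

theorem finite_inter_integerPoints {d : ℕ} {K : Set (Fin d → ℝ)} (hK : Bornology.IsBounded K) :
    (K ∩ integerPoints d).Finite := by
  obtain ⟨C, hC⟩ := hK.exists_norm_le
  refine ((Set.finite_Icc (fun _ : Fin d => -⌈C⌉) fun _ => ⌈C⌉).image
    fun m i => (m i : ℝ)).subset ?_
  rw [integerPoints_eq_range]
  rintro _ ⟨hx, m, rfl⟩
  have h (i : Fin d) : |m i| ≤ ⌈C⌉ := by
    have := (norm_le_pi_norm (fun i => (m i : ℝ)) i).trans ((hC _ hx).trans (Int.le_ceil C))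
    rw [Real.norm_eq_abs] at this
    exact_mod_cast this
  exact ⟨m, ⟨fun i => (abs_le.1 (h i)).1, fun i => (abs_le.1 (h i)).2⟩, rfl⟩

theorem exists_ae_latticeCount_eq {d : ℕ} {P : Set (Fin d → ℝ)} (hP : IsIntegerZonotope P) :
    ∃ c : ℕ, ∀ᵐ x ∂(MeasureTheory.volume : MeasureTheory.Measure (Fin d → ℝ)),
      latticeCount P x = c := by
  obtain ⟨⟨n, a, b, rfl⟩, hint⟩ := hP
  obtain ⟨p, l, hP, hl⟩ := exists_isReducedGenerators_sum_segment Finset.univ a b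
  rw [hP] at hint ⊢
  rw [HasIntegerVertices, ← coe_integerSubgroup] at hint
  have hcount : (integerSubgroup d : Set (Fin d → ℝ)).Countable := by
    rw [coe_integerSubgroup, integerPoints_eq_range]
    exact Set.countable_range _
  obtain ⟨c, S, hS, hS', hc⟩ := exists_encard_zonotope_add_inter_eq l.length _
    (integerSubgroup d) hcount l rfl (hl.mem_addSubgroup hint)
  have hae : ∀ᵐ x ∂(MeasureTheory.volume : MeasureTheory.Measure (Fin d → ℝ)),
      latticeCount ({p} + zonotope l) x = c := by
    have h : ∀ᵐ y ∂(MeasureTheory.volume : MeasureTheory.Measure (Fin d → ℝ)),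
        ∀ E ∈ S, y ∉ E := by
      rw [MeasureTheory.ae_ball_iff hS]
      intro E hE
      exact MeasureTheory.measure_eq_zero_iff_ae_notMem.1
        (MeasureTheory.Measure.addHaar_affineSubspace _ E (hS' E hE))
    -- The offset `p` is absorbed into the translation vector.
    filter_upwards [(MeasureTheory.measurePreserving_add_left
      MeasureTheory.volume p).quasiMeasurePreserving.ae h] with x hx
    rw [← hc _ hx, latticeCount, coe_integerSubgroup, add_right_comm, Set.singleton_add_singleton,
      add_comm]
  -- One translate attaining `c` is bounded, so `c` is finite.
  obtain ⟨x, hx⟩ := hae.exists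
  have hfin : c ≠ ⊤ := by
    rw [← hx, latticeCount, Set.encard_ne_top_iff]
    exact finite_inter_integerPoints
      ((isCompact_singleton.add (isCompact_zonotope l)).add isCompact_singleton).isBounded
  lift c to ℕ using hfin
  exact ⟨c, hae⟩

end Main

theorem mainTheorem4 {d : ℕ} (P : Set (Fin d → ℝ)) (hP : IsIntegerZonotope P)
    {Ω : Type*} [MeasurableSpace Ω] (μ : MeasureTheory.Measure Ω)
    [MeasureTheory.IsProbabilityMeasure μ] (X : Ω → Fin d → ℝ)
    (hX : MeasureTheory.pdf.IsUniform X (Set.Icc 0 1) μ MeasureTheory.volume) :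
    ∃ c : ℕ, ∀ᵐ ω ∂μ, latticeCount P (X ω) = (c : ℕ∞) := by
  obtain ⟨c, hc⟩ := exists_ae_latticeCount_eq hP
  have hX' : AEMeasurable X μ :=
    hX.aemeasurable (by simp [Real.volume_Icc_pi]) (by simp [Real.volume_Icc_pi])
  exact ⟨c, MeasureTheory.ae_of_ae_map hX' (hX.absolutelyContinuous.ae_le hc)⟩
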